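/- A set $\Omega$ in a finite-dimensional real space is called nearly convex if there is a convex set $C$ with $C\subset\Omega\subset\overline{C}$. For a function $f\colon\mathbb R^m\to[-\infty,\infty]$ let $\operatorname{dom} f=\{x\mid f(x)<\infty\}$ and $\operatorname{epi} f=\{(x,\lambda)\in\mathbb R^m\times\mathbb R\mid f(x)\le\lambda\}$. The function $f$ is nearly convex if $\operatorname{epi} f$ is a nearly convex set, and proper if $\operatorname{dom} f\ne\emptyset$ and $f(x)>-\infty$ for all $x$. Its Fenchel conjugate is $f^*(v)=\sup\{\langle v,x\rangle-f(x)\mid x\in\mathbb R^m\}\in[-\infty,\infty]$. Let $\operatorname{ri}$ denote the relative interior, i.e. the interior relative to the affine hull, and let $\inf\emptyset=\infty$. **Theorem.** Let $g\colon\mathbb R^p\to[-\infty,\infty]$ be a proper nearly convex function and let $A\in\mathbb R^{p\times n}$. Suppose that $$A(\mathbb R^n)\cap\operatorname{ri}(\operatorname{dom} g)\neq\emptyset.$$ Then $$(g\circ A)^*(w)=\inf\{g^*(v)\mid v\in\mathbb R^p,\ A^Tv=w\}\quad\text{for all } w\in\mathbb R^n.$$ In addition, for every $w\in\mathbb R^n$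 with $(g\circ A)^*(w)\in\mathbb R$, there exists a vector $v\in\mathbb R^p$ such that $A^Tv=w$ and $(g\circ A)^*(w)=g^*(v)$. -/

import Mathlib

/-- A subset `Ω` is nearly convex if `C ⊆ Ω ⊆ closure C` for some convex set `C`. -/
def NearlyConvexSet {E : Type*} [AddCommGroup E] [Module ℝ E] [TopologicalSpace E]
    (Ω : Set E) : Prop :=
  ∃ C : Set E, Convex ℝ C ∧ C ⊆ Ω ∧ Ω ⊆ closure C

/-- The effective domain of an extended-real-valued function. -/
def effDom {E : Type*} (f : E → EReal) : Set E :=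
  {x | f x < ⊤}

/-- The epigraph of an extended-real-valued function, as a subset of `E × ℝ`. -/
def epigraph {E : Type*} (f : E → EReal) : Set (E × ℝ) :=
  {q | f q.1 ≤ (q.2 : EReal)}

/-- An extended-real-valued function is nearly convex if its epigraph is a nearly convex set. -/
def NearlyConvexFun {E : Type*} [AddCommGroup E] [Module ℝ E] [TopologicalSpace E]
    (f : E → EReal) : Prop :=
  NearlyConvexSet (epigraph f)

/-- An extended-real-valued function is proper if its effective domain is nonempty and it never
takes the value `-∞`. -/
def ProperFun {E : Type*} (f : E → EReal) : Prop :=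
  (effDom f).Nonempty ∧ ∀ x, ⊥ < f x

/-- The Fenchel conjugate `f*(v) = sup {⟪v, x⟫ - f x | x}`, with values in `[-∞, ∞]`. The first
term is always a real number, so the difference is never of the form `∞ - ∞`. -/
noncomputable def fenchelConj {E : Type*} [NormedAddCommGroup E] [InnerProductSpace ℝ E]
    (f : E → EReal) (v : E) : EReal :=
  ⨆ x : E, ((inner ℝ v x : ℝ) : EReal) - f x

section

open Set Submodule
open scoped Pointwise

/-! The inequality `≤` is immediate, since `A x` is one of the points competing in `g*(v)`. For the
converse with attainment, let `c` be the finite value of the left side and `C` a convex set with `C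
⊆ epi g ⊆ closure C`. Then `l - ⟪w, x⟫ + c ≥ 0` whenever `(A x, l) ∈ C`. This makes `(0, t) ↦ t`
nonnegative on the part of a suitable convex cone in `F × ℝ` lying over `0`. The relative interior
condition supplies the cofinality needed for M. Riesz extension, and the extension `(u, t) ↦ ψ u +
t` yields `v = -ψ`. -/

/-- The affine hull of `s` is closed, so it contains any open part of `closure s`; if there is one,
the hull is everything and `s` itself has interior. -/
theorem Convex.interior_closure_subset_of_finiteDimensional {E : Type*} [NormedAddCommGroup E]
    [NormedSpace ℝ E] [FiniteDimensional ℝ E] {s : Set E} (hs : Convex ℝ s) :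
    interior (closure s) ⊆ interior s := by
  intro z hz
  have hne : (interior s).Nonempty := by
    rw [hs.interior_nonempty_iff_affineSpan_eq_top]
    have hsub : closure s ⊆ affineSpan ℝ s :=
      closure_minimal (subset_affineSpan ℝ s) (AffineSubspace.closed_of_finiteDimensional _)
    have htop : affineSpan ℝ (interior (closure s)) = ⊤ :=
      isOpen_interior.affineSpan_eq_top ⟨z, hz⟩
    rw [eq_top_iff, ← htop]
    exact affineSpan_le.2 (interior_subset.trans hsub)
  rwa [hs.interior_closure_eq_interior_of_nonempty_interior hne] at hz

/-- The M. Riesz extension theorem for a convex cone that need not contain the origin. -/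
theorem ConvexCone.exists_nonneg_extension {E : Type*} [AddCommGroup E] [Module ℝ E]
    (K : ConvexCone ℝ E) (f : E →ₗ.[ℝ] ℝ) (nonneg : ∀ x : f.domain, (x : E) ∈ K → 0 ≤ f x)
    (dense : ∀ y, ∃ x : f.domain, (x : E) + y ∈ K) :
    ∃ φ : E →ₗ[ℝ] ℝ, (∀ x : f.domain, φ x = f x) ∧ ∀ x ∈ K, 0 ≤ φ x := by
  let T : ConvexCone ℝ E :=
    { carrier := insert 0 (K : Set E)
      smul_mem' := by
        rintro c hc x (rfl | hx)
        · exact Or.inl (smul_zero c)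
        · exact Or.inr (K.smul_mem hc hx)
      add_mem' := by
        rintro x (rfl | hx) y (rfl | hy)
        · exact Or.inl (add_zero 0)
        · exact Or.inr ((zero_add y).symm ▸ hy)
        · exact Or.inr ((add_zero x).symm ▸ hx)
        · exact Or.inr (K.add_mem hx hy) }
  have hT : T.Pointed := Or.inl rfl
  obtain ⟨φ, hφf, hφ⟩ := riesz_extension (T.toPointedCone hT) f
    (by
      rintro x (hx | hx)
      · rw [show x = 0 from Subtype.ext hx, f.map_zero]
      · exact nonneg x hx)
    (fun y => (dense y).imp fun _ hx => Or.inr hx)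
  exact ⟨φ, hφf, fun x hx => hφ x (Or.inr hx)⟩

variable {F : Type*} [NormedAddCommGroup F] [InnerProductSpace ℝ F]

variable {G : Type*} [NormedAddCommGroup G] [InnerProductSpace ℝ G]

theorem fenchelConj_comp_le (g : F → EReal) (A : G →ₗ[ℝ] F) {w : G} {v : F}
    (hv : ∀ x, inner ℝ v (A x) = inner ℝ w x) :
    fenchelConj (fun x => g (A x)) w ≤ fenchelConj g v := by
  refine iSup_le fun x => ?_
  rw [← hv x]
  exact le_iSup (fun y => ((inner ℝ v y : ℝ) : EReal) - g y) (A x)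

variable [FiniteDimensional ℝ F]

/-- A convex set is absorbing, in the directions of its affine hull, at every relative interior
point of a set lying between it and its closure. -/
theorem Convex.exists_pos_add_smul_mem_of_mem_intrinsicInterior {D Ω : Set F} (hD : Convex ℝ D)
    (hDΩ : D ⊆ Ω) (hΩD : Ω ⊆ closure D) {y : F} (hy : y ∈ intrinsicInterior ℝ Ω) {a : F}
    (ha : a ∈ (affineSpan ℝ Ω).direction) : ∃ ε : ℝ, 0 < ε ∧ y + ε • a ∈ D := by
  set V := (affineSpan ℝ Ω).direction with hV
  have hyM : y ∈ affineSpan ℝ Ω := subset_affineSpan ℝ Ω (intrinsicInterior_subset hy)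
  have hball : ∃ r > 0, ∀ z ∈ affineSpan ℝ Ω, dist z y < r → z ∈ Ω := by
    obtain ⟨y', hy', rfl⟩ := mem_intrinsicInterior.1 hy
    obtain ⟨r, hr, h⟩ := Metric.mem_nhds_iff.1 (mem_interior_iff_mem_nhds.1 hy')
    exact ⟨r, hr, fun z hz hd => @h ⟨z, hz⟩ hd⟩
  obtain ⟨r, hr, hball⟩ := hball
  -- Thickening by `Vᗮ` turns relative interior into interior; points of `D'` in the affine hull
  -- still lie in `D`.
  set D' : Set F := D + (Vᗮ : Set F) with hD'
  have hD'c : Convex ℝ D' := hD.add (Submodule.convex _)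
  have hint : y ∈ interior (closure D') := by
    refine mem_interior_iff_mem_nhds.2 (Metric.mem_nhds_iff.2 ⟨r, hr, fun z hz => ?_⟩)
    set u : F := V.starProjection (z - y) with hu
    have huV : u ∈ V := V.starProjection_apply_mem _
    have hmem : u + y ∈ closure D := by
      refine hΩD (hball _ (AffineSubspace.vadd_mem_of_mem_direction huV hyM) ?_)
      rw [dist_eq_norm, add_sub_cancel_right]
      refine lt_of_le_of_lt (V.norm_starProjection_apply_le _) ?_
      rwa [← dist_eq_norm]
    have hq : z - y - u ∈ Vᗮ := V.sub_starProjection_mem_orthogonal _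
    have himg : u + y + (z - y - u) ∈ closure D' :=
      map_mem_closure (f := fun x => x + (z - y - u)) (by fun_prop) hmem
        fun x hx => Set.add_mem_add hx hq
    rwa [show u + y + (z - y - u) = z by abel] at himg
  have hnhds : D' ∈ nhds y :=
    mem_interior_iff_mem_nhds.1 (hD'c.interior_closure_subset_of_finiteDimensional hint)
  have htend : Filter.Tendsto (fun ε : ℝ => y + ε • a) (nhdsWithin 0 (Ioi 0)) (nhds y) := by
    have hc : Continuous fun ε : ℝ => y + ε • a := by fun_prop
    have := hc.tendsto 0
    simp only [zero_smul, add_zero] at this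
    exact this.mono_left nhdsWithin_le_nhds
  obtain ⟨ε, hεD, hε⟩ := ((htend.eventually hnhds).and self_mem_nhdsWithin).exists
  refine ⟨ε, hε, ?_⟩
  obtain ⟨d, hd, q, hq, hdq⟩ := Set.mem_add.1 (show y + ε • a ∈ D' from hεD)
  have hqV : q ∈ V := by
    have : q = (y -ᵥ d) + ε • a := by
      rw [vsub_eq_sub, eq_sub_of_add_eq' hdq]; abel
    rw [this]
    exact V.add_mem (AffineSubspace.vsub_mem_direction hyM (subset_affineSpan ℝ Ω (hDΩ hd)))
      (V.smul_mem _ ha)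
  have hq0 : q = 0 := by
    have := V.inf_orthogonal_eq_bot.le ⟨hqV, hq⟩
    simpa using this
  rw [← hdq, hq0, add_zero]
  exact hd

/-- If the affine function `(x, l) ↦ l - ⟪w, x⟫ + c` is nonnegative on the preimage of a convex
set `C` under `(x, l) ↦ (A x, l)`, then, under a relative interior condition, this is witnessed by
a linear functional on the target space. -/
theorem exists_dual_vector_of_convex {C : Set (F × ℝ)} (hC : Convex ℝ C) {Ω : Set F}
    (hCΩ : Prod.fst '' C ⊆ Ω) (hΩC : Ω ⊆ closure (Prod.fst '' C)) (A : G →ₗ[ℝ] F) {x₀ : G}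
    (hx₀ : A x₀ ∈ intrinsicInterior ℝ Ω) (w : G) (c : ℝ)
    (hle : ∀ x l, (A x, l) ∈ C → 0 ≤ l - inner ℝ w x + c) :
    ∃ v : F, (∀ x, inner ℝ v (A x) = inner ℝ w x) ∧ ∀ q ∈ C, inner ℝ v q.1 - q.2 ≤ c := by
  set V := (affineSpan ℝ Ω).direction with hV
  set L := V ⊔ LinearMap.range A with hL
  have hx₀M : A x₀ ∈ affineSpan ℝ Ω := subset_affineSpan ℝ Ω (intrinsicInterior_subset hx₀)
  have hDc : Convex ℝ (Prod.fst '' C) := hC.linear_image (LinearMap.fst ℝ F ℝ)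
  -- The summand `q` fills the directions outside `L`, so that cofinality holds in all of `F × ℝ`;
  -- over `0` it is forced to vanish.
  let S : Set (F × ℝ) := {z | ∃ y l x, ∃ q ∈ Lᗮ, (y, l) ∈ C ∧
    z = (y - A x + q, l - inner ℝ w x + c)}
  have hS : Convex ℝ S := by
    rintro _ ⟨y₁, l₁, x₁, q₁, hq₁, h₁, rfl⟩ _ ⟨y₂, l₂, x₂, q₂, hq₂, h₂, rfl⟩ a b ha hb hab
    refine ⟨a • y₁ + b • y₂, a * l₁ + b * l₂, a • x₁ + b • x₂, a • q₁ + b • q₂,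
      add_mem (smul_mem _ _ hq₁) (smul_mem _ _ hq₂), hC h₁ h₂ ha hb hab, ?_⟩
    ext1
    · simp only [Prod.fst_add, Prod.smul_fst, map_add, map_smul]
      module
    · simp only [Prod.snd_add, Prod.smul_snd, smul_eq_mul, inner_add_right, inner_smul_right]
      linear_combination c * hab
  let f : (F × ℝ) →ₗ.[ℝ] ℝ :=
    { domain := (⊥ : Submodule ℝ F).prod ⊤
      toFun := (LinearMap.snd ℝ F ℝ).comp (Submodule.subtype _) }
  have hnonneg : ∀ z : f.domain, (z : F × ℝ) ∈ ConvexCone.hull ℝ S → 0 ≤ f z := by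
    rintro ⟨⟨u, t⟩, hu⟩ hz
    have hu0 : u = 0 := by simpa using (Submodule.mem_prod.1 hu).1
    obtain ⟨s, hs, _, ⟨y, l, x, q, hq, hyl, rfl⟩, hz⟩ := (ConvexCone.mem_hull_of_convex hS).1 hz
    obtain ⟨hz₁, hz₂⟩ := Prod.ext_iff.1 hz
    change 0 ≤ t
    simp only [Prod.smul_fst, Prod.smul_snd, smul_eq_mul, hu0] at hz₁ hz₂
    have h0 : y - A x + q = 0 := (smul_eq_zero.1 hz₁).resolve_left hs.ne'
    have hyL : y - A x ∈ L := by
      have h1 : y -ᵥ A x₀ ∈ V := AffineSubspace.vsub_mem_direction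
        (subset_affineSpan ℝ Ω (hCΩ ⟨_, hyl, rfl⟩)) hx₀M
      have h2 : A (x₀ - x) ∈ LinearMap.range A := ⟨_, rfl⟩
      have := add_mem (mem_sup_left (T := LinearMap.range A) h1) (mem_sup_right (S := V) h2)
      rwa [vsub_eq_sub, map_sub, sub_add_sub_cancel] at this
    have hqL : q ∈ L := by
      rw [eq_neg_of_add_eq_zero_right h0]
      exact neg_mem hyL
    have hq0 : q = 0 := by simpa using L.inf_orthogonal_eq_bot.le ⟨hqL, hq⟩
    rw [hq0, add_zero, sub_eq_zero] at h0
    rw [← hz₂]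
    exact mul_nonneg hs.le (hle x l (h0 ▸ hyl))
  have hdense : ∀ z : F × ℝ, ∃ t : f.domain, (t : F × ℝ) + z ∈ ConvexCone.hull ℝ S := by
    rintro ⟨u, t⟩
    obtain ⟨l, hl, m, hm, rfl⟩ := Submodule.mem_sup.1
      (show u ∈ L ⊔ Lᗮ by rw [L.sup_orthogonal_of_hasOrthogonalProjection]; trivial)
    obtain ⟨a, ha, _, ⟨x, rfl⟩, rfl⟩ := Submodule.mem_sup.1 hl
    obtain ⟨ε, hε, ⟨⟨y, k⟩, hyk, hy⟩⟩ :=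
      hDc.exists_pos_add_smul_mem_of_mem_intrinsicInterior hCΩ hΩC hx₀ ha
    have hy : y = A x₀ + ε • a := hy
    -- With `x₀ - ε • x` and `ε • m`, the first coordinate is `ε • (a + A x + m)`; the vertical
    -- shift corrects the height.
    refine ⟨⟨(0, ε⁻¹ * (k - inner ℝ w (x₀ - ε • x) + c) - t), by simp [f]⟩,
      (ConvexCone.mem_hull_of_convex hS).2 ⟨ε⁻¹, inv_pos.2 hε, _,
        ⟨y, k, x₀ - ε • x, ε • m, smul_mem _ _ hm, hyk, rfl⟩, ?_⟩⟩
    ext1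
    · simp only [Prod.smul_fst, Prod.fst_add, zero_add, hy, map_sub, map_smul]
      rw [show A x₀ + ε • a - (A x₀ - ε • A x) + ε • m = ε • (a + A x + m) by module,
        inv_smul_smul₀ hε.ne']
    · simp
  obtain ⟨φ, hφf, hφ⟩ := (ConvexCone.hull ℝ S).exists_nonneg_extension f hnonneg hdense
  have hφ1 : ∀ t : ℝ, φ (0, t) = t := fun t => hφf ⟨(0, t), by simp [f]⟩
  set ψ : F →ₗ[ℝ] ℝ := φ.comp (LinearMap.inl ℝ F ℝ) with hψ
  have hφψ : ∀ u t, φ (u, t) = ψ u + t := by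
    intro u t
    rw [show ((u, t) : F × ℝ) = (u, 0) + (0, t) by simp, map_add, hφ1]
    rfl
  have hmain : ∀ q ∈ C, ∀ x, 0 ≤ ψ q.1 - ψ (A x) + (q.2 - inner ℝ w x + c) := by
    intro q hq x
    rw [← map_sub, ← hφψ]
    refine hφ _ ((ConvexCone.mem_hull_of_convex hS).2 ⟨1, one_pos, _, ⟨q.1, q.2, x, 0, zero_mem _, hq, rfl⟩, ?_⟩)
    simp
  have hCne : C.Nonempty := by
    have : (Prod.fst '' C).Nonempty :=
      closure_nonempty_iff.1 ⟨_, hΩC (intrinsicInterior_subset hx₀)⟩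
    exact this.of_image
  have hlin : ∀ x, ψ (A x) + inner ℝ w x = 0 := by
    intro x
    obtain ⟨q, hq⟩ := hCne
    set b := ψ (A x) + inner ℝ w x with hb
    set k := ψ q.1 + q.2 + c with hk
    by_contra hne
    -- This multiple of `x` makes the right side of `hmain` equal to `-1`.
    have := hmain q hq (((k + 1) / b) • x)
    rw [map_smul, map_smul, inner_smul_right, smul_eq_mul] at this
    have h2 : (k + 1) / b * ψ (A x) + (k + 1) / b * inner ℝ w x = k + 1 := by
      rw [← mul_add, ← hb, div_mul_cancel₀ _ hne]
    linarith
  have hrep : ∀ y, inner ℝ ((InnerProductSpace.toDual ℝ F).symm (-ψ).toContinuousLinearMap) y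
      = -ψ y := by
    intro y
    rw [InnerProductSpace.toDual_symm_apply]
    rfl
  refine ⟨(InnerProductSpace.toDual ℝ F).symm (-ψ).toContinuousLinearMap, fun x => ?_,
    fun q hq => ?_⟩
  · rw [hrep]
    linarith [hlin x]
  · rw [hrep]
    have := hmain q hq 0
    simp only [map_zero, inner_zero_right] at this
    linarith

/-- Under the relative interior condition, a real upper bound on the conjugate of `g ∘ A` at `w`
is an upper bound on the conjugate of `g` at some preimage of `w` under the adjoint of `A`. -/
theorem NearlyConvexFun.exists_fenchelConj_le {g : F → EReal} (hproper : ProperFun g)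
    (hconv : NearlyConvexFun g) (A : G →ₗ[ℝ] F) {x₀ : G}
    (hx₀ : A x₀ ∈ intrinsicInterior ℝ (effDom g)) {w : G} {c : ℝ}
    (hc : fenchelConj (fun x => g (A x)) w ≤ c) :
    ∃ v : F, (∀ x, inner ℝ v (A x) = inner ℝ w x) ∧ fenchelConj g v ≤ c := by
  obtain ⟨C, hC, hCg, hgC⟩ := hconv
  have hCΩ : Prod.fst '' C ⊆ effDom g := by
    rintro _ ⟨q, hq, rfl⟩
    exact lt_of_le_of_lt (hCg hq) (EReal.coe_lt_top _)
  have hΩC : effDom g ⊆ closure (Prod.fst '' C) := by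
    intro y hy
    have hyC : (y, (g y).toReal) ∈ closure C := hgC (EReal.le_coe_toReal (ne_of_lt hy))
    exact map_mem_closure continuous_fst hyC fun q hq => ⟨q, hq, rfl⟩
  have hle : ∀ x l, (A x, l) ∈ C → 0 ≤ l - inner ℝ w x + c := by
    intro x l hl
    have h1 : g (A x) ≤ l := hCg hl
    have h2 : ((inner ℝ w x : ℝ) : EReal) - l ≤ c :=
      (EReal.sub_le_sub le_rfl h1).trans
        ((le_iSup (fun x => ((inner ℝ w x : ℝ) : EReal) - g (A x)) x).trans hc)
    have h3 : inner ℝ w x - l ≤ c := by exact_mod_cast h2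
    linarith
  obtain ⟨v, hv, hvC⟩ := exists_dual_vector_of_convex hC hCΩ hΩC A hx₀ w c hle
  refine ⟨v, hv, iSup_le fun y => ?_⟩
  -- Closedness carries the bound from `C` to the whole epigraph.
  have hclosed : IsClosed {q : F × ℝ | inner ℝ v q.1 - q.2 ≤ c} :=
    isClosed_le (by fun_prop) continuous_const
  have hepi : epigraph g ⊆ {q : F × ℝ | inner ℝ v q.1 - q.2 ≤ c} :=
    hgC.trans (closure_minimal hvC hclosed)
  by_cases hy : g y = ⊤
  · simp [hy]
  · have h1 : inner ℝ v y - (g y).toReal ≤ c :=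
      hepi (show (y, (g y).toReal) ∈ epigraph g from EReal.le_coe_toReal hy)
    rw [← EReal.coe_toReal hy (hproper.2 y).ne']
    exact_mod_cast h1

end

theorem Matrix.toEuclideanLin_transpose_eq_iff {n p : ℕ} (A : Matrix (Fin p) (Fin n) ℝ)
    (v : EuclideanSpace ℝ (Fin p)) (w : EuclideanSpace ℝ (Fin n)) :
    Matrix.toEuclideanLin A.transpose v = w ↔
      ∀ x, inner ℝ v (Matrix.toEuclideanLin A x) = inner ℝ w x := by
  rw [← Matrix.conjTranspose_eq_transpose_of_trivial,
    Matrix.toEuclideanLin_conjTranspose_eq_adjoint, ext_iff_inner_right ℝ]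
  simp only [LinearMap.adjoint_inner_left]

theorem theorem6p7 (n p : ℕ) (g : EuclideanSpace ℝ (Fin p) → EReal)
    (hproper : ProperFun g) (hconv : NearlyConvexFun g)
    (A : Matrix (Fin p) (Fin n) ℝ)
    (hqual : (Set.range (Matrix.toEuclideanLin A) ∩ intrinsicInterior ℝ (effDom g)).Nonempty) :
    (∀ w : EuclideanSpace ℝ (Fin n),
      fenchelConj (fun x => g (Matrix.toEuclideanLin A x)) w =
        sInf {r : EReal | ∃ v : EuclideanSpace ℝ (Fin p),
          Matrix.toEuclideanLin A.transpose v = w ∧ fenchelConj g v = r}) ∧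
    (∀ w : EuclideanSpace ℝ (Fin n),
      (∃ c : ℝ, fenchelConj (fun x => g (Matrix.toEuclideanLin A x)) w = (c : EReal)) →
        ∃ v : EuclideanSpace ℝ (Fin p), Matrix.toEuclideanLin A.transpose v = w ∧
          fenchelConj (fun x => g (Matrix.toEuclideanLin A x)) w = fenchelConj g v) := by
  obtain ⟨_, ⟨x₀, rfl⟩, hx₀⟩ := hqual
  set B := Matrix.toEuclideanLin A with hB
  have hattain : ∀ (w : EuclideanSpace ℝ (Fin n)) (c : ℝ),
      fenchelConj (fun x => g (B x)) w = (c : EReal) →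
        ∃ v : EuclideanSpace ℝ (Fin p), Matrix.toEuclideanLin A.transpose v = w ∧
          fenchelConj (fun x => g (B x)) w = fenchelConj g v := by
    intro w c hc
    obtain ⟨v, hv, hle⟩ := hconv.exists_fenchelConj_le hproper B hx₀ hc.le
    exact ⟨v, (A.toEuclideanLin_transpose_eq_iff v w).2 hv,
      le_antisymm (fenchelConj_comp_le g B hv) (hc ▸ hle)⟩
  refine ⟨fun w => le_antisymm ?_ ?_, fun w ⟨c, hc⟩ => hattain w c hc⟩
  · refine le_sInf ?_
    rintro _ ⟨v, hv, rfl⟩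
    exact fenchelConj_comp_le g B ((A.toEuclideanLin_transpose_eq_iff v w).1 hv)
  · by_cases htop : fenchelConj (fun x => g (B x)) w = ⊤
    · rw [htop]
      exact le_top
    have hbot : fenchelConj (fun x => g (B x)) w ≠ ⊥ := by
      have hfin : g (B x₀) ≠ ⊤ := (show B x₀ ∈ effDom g from _root_.intrinsicInterior_subset hx₀).ne
      have hle := le_iSup (fun x => ((inner ℝ w x : ℝ) : EReal) - g (B x)) x₀
      refine ne_bot_of_le_ne_bot ?_ hle
      rw [← EReal.coe_toReal hfin (hproper.2 _).ne', ← EReal.coe_sub]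
      exact EReal.coe_ne_bot _
    obtain ⟨v, hv, heq⟩ := hattain w _ (EReal.coe_toReal htop hbot).symm
    exact sInf_le ⟨v, hv, heq.symm⟩
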